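/- All Hilbert spaces are finite-dimensional and nonzero, $\log$ is the logarithm to base $2$, and values in $[-\infty,\infty]$ are allowed ($\log 0=-\infty$, $\log\infty=\infty$, $0^{-1}=\infty$, $\sup\emptyset=-\infty$, $\inf\emptyset=\infty$). For states put $F(\rho,\sigma)=\|\sqrt\rho\sqrt\sigma\|_1^2$, $D_{\max}(\rho\|\sigma)=\inf\{\lambda\in\mathbb R : \rho\le 2^\lambda\sigma\}$ and $D_{\min}(\rho\|\sigma)=-\log\mathrm{Tr}[\Pi_\rho\sigma]$, where $\Pi_\rho$ is the projector onto the support of $\rho$. For channels (completely positive trace-preserving maps) $\mathcal E_1,\mathcal E_2$ with common input and output systems put $F(\mathcal E_1,\mathcal E_2)=\inf_\psi F(\mathrm{id}\otimes\mathcal E_1(\psi),\mathrm{id}\otimes\mathcal E_2(\psi))$, the infimum being over all pure states $\psi$ of the input system together with a reference system of any dimension. For a set $\mathbb O$ of channels put $$D_{\max,\mathbb O}(\mathcal E)=\inf_{\mathcal M\in\mathbb O}\sup_\psi D_{\max}(\mathrm{id}\otimes\mathcal E(\psi)\|\mathrm{id}\otimes\mathcal M(\psi)),\qquad D_{\min,\mathbb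 O}(\mathcal E)=\inf_{\mathcal M\in\mathbb O}\sup_\psi D_{\min}(\mathrm{id}\otimes\mathcal E(\psi)\|\mathrm{id}\otimes\mathcal M(\psi)),$$ where $\mathcal M$ ranges over the members of $\mathbb O$ with the same input and output systems as $\mathcal E$. A superchannel is a linear map taking channels to channels that is realized by a pre-processing and a post-processing channel connected by a quantum memory. Let $\mathbb O\subseteq\mathbb O_{\rm all}$ and $\mathbb O'\subseteq\mathbb O'_{\rm all}$ be two resource theories, i.e. arbitrary sets of free channels inside arbitrary sets of channels of interest (between arbitrary systems). A superchannel $\Theta$ from the first theory to the second belongs to the maximal set $\mathbb S_{\max}$ of free superchannels if it maps $\mathbb O_{\rm all}$ into $\mathbb O'_{\rm all}$ and $\mathbb O$ into $\mathbb O'$; likewise for superchannels from the second theory to the first. Let $\mathbb T\subseteq\mathbb O'_{\rm all}$ be a set of reference channels. For a set $\mathbb S$ of superchannels, a channel $\mathcal E$ and $\epsilon\in[0,1]$ put $$d^{\epsilon}_{\mathbb S}(\mathcal E)=\sup\{D_{\min,\mathbb O'}(\mathcal T) : F(\Theta(\mathcal E),\mathcal T)\ge 1-\epsilon,\ \mathcal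 T\in\mathbb T,\ \Theta\in\mathbb S\},$$ $$c^{\epsilon}_{\mathbb S}(\mathcal E)=\inf\{D_{\min,\mathbb O'}(\mathcal T) : F(\mathcal E,\Theta(\mathcal T))\ge 1-\epsilon,\ \mathcal T\in\mathbb T,\ \Theta\in\mathbb S\}.$$ **Theorem.** Suppose that for every $\mathcal T\in\mathbb T$ the output $\mathrm{id}\otimes\mathcal T(\psi)$ is pure for every pure state $\psi$ (with every reference system), and that $D_{\min,\mathbb O'}(\mathcal T)=D_{\max,\mathbb O'}(\mathcal T)$. Then for all $\epsilon_1\in[0,1)$ and $\epsilon_2\in[0,1-\epsilon_1]$, every quantum channel $\mathcal E$, and all sets $\mathbb S\subseteq\mathbb S_{\max}$ of free superchannels from the first theory to the second and $\mathbb S'\subseteq\mathbb S_{\max}$ of free superchannels from the second theory to the first, $$d^{\epsilon_1}_{\mathbb S}(\mathcal E)\le c^{\epsilon_2}_{\mathbb S'}(\mathcal E)+\log f(\epsilon_1,\epsilon_2),$$ where $f(\epsilon_1,\epsilon_2)=\min\{(1-\epsilon_1-\sqrt{\epsilon_2})^{-1},(\sqrt{1-\epsilon_2}-\sqrt{\epsilon_1})^{-2}\}$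 if $\epsilon_1+\sqrt{\epsilon_2}<1$ and $f(\epsilon_1,\epsilon_2)=(\sqrt{1-\epsilon_2}-\sqrt{\epsilon_1})^{-2}$ otherwise (so $f=\infty$ if $\epsilon_1+\epsilon_2=1$). In particular, if the two theories coincide, one may take $\mathbb S'=\mathbb S$. -/

import Mathlib

open scoped ENNReal Matrix ComplexOrder MatrixOrder

noncomputable section

namespace ResourceTheory

/-! ### States

A finite-dimensional quantum system is given by a finite nonempty index type `A` of an orthonormal
basis, so that its Hilbert space is `ℂ^A` and its operators are `Matrix A A ℂ`. The composite of
`A` and `B` is `A × B`. -/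

/-- Unit vectors of `ℂ^A`. -/
def UnitVec (A : Type*) [Fintype A] : Type _ := {ψ : A → ℂ // star ψ ⬝ᵥ ψ = 1}

/-- The pure state `|ψ⟩⟨ψ|`. -/
def UnitVec.proj {A : Type*} [Fintype A] (ψ : UnitVec A) : Matrix A A ℂ :=
  Matrix.vecMulVec ψ.1 (star ψ.1)

/-- `ρ` is a pure state. -/
def IsPureState {A : Type*} [Fintype A] (ρ : Matrix A A ℂ) : Prop :=
  ∃ φ : UnitVec A, ρ = φ.proj

/-- The trace norm `‖X‖₁ = Tr |X|` with `|X| = √(Xᴴ X)`. -/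
def traceNorm {A : Type*} [Fintype A] [DecidableEq A] (X : Matrix A A ℂ) : ℝ :=
  (CFC.sqrt (Xᴴ * X)).trace.re

/-- The fidelity `F(ρ, σ) = ‖√ρ √σ‖₁²`. -/
def fidelity {A : Type*} [Fintype A] [DecidableEq A] (ρ σ : Matrix A A ℂ) : ℝ :=
  traceNorm (CFC.sqrt ρ * CFC.sqrt σ) ^ 2

/-- The orthogonal projector onto the support (the range) of a Hermitian matrix `ρ`. -/
def supportProj {A : Type*} [Fintype A] [DecidableEq A] (ρ : Matrix A A ℂ) : Matrix A A ℂ :=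
  Matrix.toEuclideanLin.symm
    ((LinearMap.range (Matrix.toEuclideanLin ρ)).starProjection :
      EuclideanSpace ℂ A →ₗ[ℂ] EuclideanSpace ℂ A)

/-- The logarithm to base two on `[0, ∞]`, with `log 0 = -∞` and `log ∞ = ∞`. -/
def log2 (x : ℝ≥0∞) : EReal :=
  if x = 0 then ⊥ else if x = ⊤ then ⊤ else ((Real.logb 2 x.toReal : ℝ) : EReal)

/-- The max-relative entropy `inf {l : ℝ | ρ ≤ 2 ^ l σ}`, which is `∞` if there is no such `l`. -/
def Dmax {A : Type*} [Fintype A] (ρ σ : Matrix A A ℂ) : EReal :=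
  ⨅ (l : ℝ) (_ : (((2 : ℝ) ^ l) • σ - ρ).PosSemidef), (l : EReal)

/-- The min-relative entropy `-log Tr[Π_ρ σ]`, which is `∞` if the trace is zero. -/
def Dmin {A : Type*} [Fintype A] [DecidableEq A] (ρ σ : Matrix A A ℂ) : EReal :=
  -log2 (ENNReal.ofReal (supportProj ρ * σ).trace.re)

/-! ### Channels -/

/-- The map `id ⊗ Φ` with a reference system `R`: it applies `Φ` to each of the `A`-blocks. -/
def idTensor (R : Type*) {A B : Type*} (Φ : Matrix A A ℂ →ₗ[ℂ] Matrix B B ℂ) :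
    Matrix (R × A) (R × A) ℂ →ₗ[ℂ] Matrix (R × B) (R × B) ℂ where
  toFun X := Matrix.of fun p q => Φ (Matrix.of fun a a' => X (p.1, a) (q.1, a')) p.2 q.2
  map_add' X Y := by
    ext p q
    exact congrFun (congrFun (map_add Φ (Matrix.of fun a a' => X (p.1, a) (q.1, a'))
      (Matrix.of fun a a' => Y (p.1, a) (q.1, a'))) p.2) q.2
  map_smul' c X := by
    ext p q
    exact congrFun (congrFun (map_smul Φ c (Matrix.of fun a a' => X (p.1, a) (q.1, a'))) p.2) q.2

/-- Complete positivity: `id ⊗ Φ` is positive for every finite-dimensional reference system. -/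
def IsCompletelyPositive {A B : Type*} (Φ : Matrix A A ℂ →ₗ[ℂ] Matrix B B ℂ) : Prop :=
  ∀ (n : ℕ) (X : Matrix (Fin n × A) (Fin n × A) ℂ),
    X.PosSemidef → (idTensor (Fin n) Φ X).PosSemidef

/-- Trace preservation. -/
def IsTracePreserving {A B : Type*} [Fintype A] [Fintype B]
    (Φ : Matrix A A ℂ →ₗ[ℂ] Matrix B B ℂ) : Prop :=
  ∀ X : Matrix A A ℂ, (Φ X).trace = X.trace

/-- Quantum channels: completely positive trace-preserving linear maps. -/
structure Channel (A B : Type*) [Fintype A] [Fintype B] where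
  toLin : Matrix A A ℂ →ₗ[ℂ] Matrix B B ℂ
  completelyPositive : IsCompletelyPositive toLin
  tracePreserving : IsTracePreserving toLin

theorem IsCompletelyPositive.comp {A B C : Type*} {Ψ : Matrix B B ℂ →ₗ[ℂ] Matrix C C ℂ}
    {Φ : Matrix A A ℂ →ₗ[ℂ] Matrix B B ℂ} (hΨ : IsCompletelyPositive Ψ)
    (hΦ : IsCompletelyPositive Φ) : IsCompletelyPositive (Ψ ∘ₗ Φ) :=
  fun n X hX => hΨ n _ (hΦ n X hX)

theorem IsCompletelyPositive.idTensor {A B : Type*} {Φ : Matrix A A ℂ →ₗ[ℂ] Matrix B B ℂ}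
    (hΦ : IsCompletelyPositive Φ) (m : ℕ) :
    IsCompletelyPositive (ResourceTheory.idTensor (Fin m) Φ) := by
  intro n X hX
  have h := hΦ (n * m) (X.submatrix
    (fun p => ((finProdFinEquiv.symm p.1).1, ((finProdFinEquiv.symm p.1).2, p.2)))
    (fun p => ((finProdFinEquiv.symm p.1).1, ((finProdFinEquiv.symm p.1).2, p.2))))
    (hX.submatrix _)
  have h2 := h.submatrix
    (fun p : Fin n × (Fin m × B) => (finProdFinEquiv (p.1, p.2.1), p.2.2))
  convert h2 using 1
  ext p q
  simp only [ResourceTheory.idTensor, LinearMap.coe_mk, AddHom.coe_mk, Matrix.of_apply,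
    Matrix.submatrix_apply, Equiv.symm_apply_apply]

theorem IsTracePreserving.idTensor {A B : Type*} [Fintype A] [Fintype B]
    {Φ : Matrix A A ℂ →ₗ[ℂ] Matrix B B ℂ} (hΦ : IsTracePreserving Φ) (m : ℕ) :
    IsTracePreserving (ResourceTheory.idTensor (Fin m) Φ) := by
  intro X
  simp only [Matrix.trace, Fintype.sum_prod_type, Matrix.diag_apply]
  refine Finset.sum_congr rfl fun r _ => ?_
  exact hΦ (Matrix.of fun a a' => X (r, a) (r, a'))

/-- The worst-case (channel) fidelity: the infimum of `F(id ⊗ E(ψ), id ⊗ N(ψ))` over all pure input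
states `ψ` of the input system together with an arbitrary finite-dimensional reference system. -/
def channelFidelity {A B : Type*} [Fintype A] [Fintype B] [DecidableEq B]
    (E N : Channel A B) : ℝ :=
  sInf {x : ℝ | ∃ (n : ℕ) (ψ : UnitVec (Fin n × A)),
    x = fidelity (idTensor (Fin n) E.toLin ψ.proj) (idTensor (Fin n) N.toLin ψ.proj)}

/-- `id ⊗ T` maps pure states to pure states. -/
def Channel.IsPure {A B : Type*} [Fintype A] [Fintype B] (T : Channel A B) : Prop :=
  ∀ (n : ℕ) (ψ : UnitVec (Fin n × A)), IsPureState (idTensor (Fin n) T.toLin ψ.proj)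

/-- `sup_ψ D_max(id ⊗ E(ψ) ‖ id ⊗ M(ψ))`. -/
def channelDmax {A B : Type*} [Fintype A] [Fintype B] (E M : Channel A B) : EReal :=
  ⨆ (n : ℕ) (ψ : UnitVec (Fin n × A)),
    Dmax (idTensor (Fin n) E.toLin ψ.proj) (idTensor (Fin n) M.toLin ψ.proj)

/-- `sup_ψ D_min(id ⊗ E(ψ) ‖ id ⊗ M(ψ))`. -/
def channelDmin {A B : Type*} [Fintype A] [Fintype B] [DecidableEq B]
    (E M : Channel A B) : EReal :=
  ⨆ (n : ℕ) (ψ : UnitVec (Fin n × A)),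
    Dmin (idTensor (Fin n) E.toLin ψ.proj) (idTensor (Fin n) M.toLin ψ.proj)

/-! ### Superchannels -/

/-- Superchannels: linear maps which take channels `A → B` to channels `A' → B'` and are realized
by a pre-processing channel and a post-processing channel, connected by a quantum memory. -/
structure Superchannel (A B A' B' : Type*) [Fintype A] [Fintype B] [Fintype A'] [Fintype B'] where
  toLin : (Matrix A A ℂ →ₗ[ℂ] Matrix B B ℂ) →ₗ[ℂ] (Matrix A' A' ℂ →ₗ[ℂ] Matrix B' B' ℂ)
  realizable : ∃ (m : ℕ) (pre : Channel A' (Fin m × A)) (post : Channel (Fin m × B) B'),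
    ∀ Φ, toLin Φ = post.toLin ∘ₗ idTensor (Fin m) Φ ∘ₗ pre.toLin

/-- The channel `Θ(E)`. -/
def Superchannel.apply {A B A' B' : Type*} [Fintype A] [Fintype B] [Fintype A'] [Fintype B']
    (Θ : Superchannel A B A' B') (E : Channel A B) : Channel A' B' where
  toLin := Θ.toLin E.toLin
  completelyPositive := by
    obtain ⟨m, pre, post, h⟩ := Θ.realizable
    rw [h]
    exact post.completelyPositive.comp
      ((E.completelyPositive.idTensor m).comp pre.completelyPositive)
  tracePreserving := by
    obtain ⟨m, pre, post, h⟩ := Θ.realizable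
    intro X
    rw [h]
    exact (post.tracePreserving _).trans
      ((E.tracePreserving.idTensor m _).trans (pre.tracePreserving X))

/-! ### Resource theories of channels

The systems under consideration are labelled by a type `Sys`, the system `s` having the basis
`H s`. -/

/-- A set of channels between the given systems (of possibly different input and output). -/
abbrev ChannelSet {Sys : Type*} (H : Sys → Type*) [∀ s, Fintype (H s)] : Type _ :=
  ∀ A B : Sys, Set (Channel (H A) (H B))

/-- A set of superchannels between the given systems. -/
abbrev SuperchannelSet {Sys : Type*} (H : Sys → Type*) [∀ s, Fintype (H s)] : Type _ :=
  ∀ A B A' B' : Sys, Set (Superchannel (H A) (H B) (H A') (H B'))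

/-- A resource theory of channels: the channels of interest and, among them, the free ones. -/
structure ChannelTheory {Sys : Type*} (H : Sys → Type*) [∀ s, Fintype (H s)] where
  all : ChannelSet H
  free : ChannelSet H
  free_subset_all : free ≤ all

section

variable {Sys : Type*} {H : Sys → Type*} [∀ s, Fintype (H s)]

/-- The maximal set of free superchannels from the theory `𝒪` to the theory `𝒪'`: those which map
channels of interest to channels of interest and free channels to free channels. -/
def maxFreeSuperchannels (𝒪 𝒪' : ChannelTheory H) : SuperchannelSet H := fun A B A' B' =>
  {Θ | (∀ E ∈ 𝒪.all A B, Θ.apply E ∈ 𝒪'.all A' B') ∧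
    ∀ M ∈ 𝒪.free A B, Θ.apply M ∈ 𝒪'.free A' B'}

/-- The max-relative entropy measure of a channel. -/
def resourceDmax (𝒪 : ChannelTheory H) {A B : Sys} (E : Channel (H A) (H B)) : EReal :=
  ⨅ M ∈ 𝒪.free A B, channelDmax E M

variable [∀ s, DecidableEq (H s)]

/-- The min-relative entropy measure of a channel. -/
def resourceDmin (𝒪 : ChannelTheory H) {A B : Sys} (E : Channel (H A) (H B)) : EReal :=
  ⨅ M ∈ 𝒪.free A B, channelDmin E M

/-- The one-shot distillable resource of `E`: the supremum of the min-relative entropy measure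
(in the target theory `𝒪'`) over the channels in the reference set `𝒯` which the superchannels in
`S` produce from `E` with error at most `ε`. -/
def distillableResource (𝒪' : ChannelTheory H) (𝒯 : ChannelSet H) (S : SuperchannelSet H) (ε : ℝ)
    {A B : Sys} (E : Channel (H A) (H B)) : EReal :=
  sSup {x : EReal | ∃ (A' B' : Sys), ∃ T ∈ 𝒯 A' B', ∃ Θ ∈ S A B A' B',
    1 - ε ≤ channelFidelity (Θ.apply E) T ∧ x = resourceDmin 𝒪' T}

/-- The one-shot dilution cost of `E`: the infimum of the min-relative entropy measure (in the
theory `𝒪'` of the reference channels) over the channels in the reference set `𝒯` from which the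
superchannels in `S` produce `E` with error at most `ε`. -/
def dilutionCost (𝒪' : ChannelTheory H) (𝒯 : ChannelSet H) (S : SuperchannelSet H) (ε : ℝ)
    {A B : Sys} (E : Channel (H A) (H B)) : EReal :=
  sInf {x : EReal | ∃ (A' B' : Sys), ∃ T ∈ 𝒯 A' B', ∃ Θ ∈ S A' B' A B,
    1 - ε ≤ channelFidelity E (Θ.apply T) ∧ x = resourceDmin 𝒪' T}

end

/-- The function `f` of the two errors, with values in `[0, ∞]` (so that `0⁻¹ = ∞`). -/
def errorFactor (ε₁ ε₂ : ℝ) : ℝ≥0∞ :=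
  if ε₁ + √ε₂ < 1 then
    min (ENNReal.ofReal (1 - ε₁ - √ε₂))⁻¹ (ENNReal.ofReal ((√(1 - ε₂) - √ε₁) ^ 2))⁻¹
  else (ENNReal.ofReal ((√(1 - ε₂) - √ε₁) ^ 2))⁻¹

end ResourceTheory

end

open ResourceTheory

/-! Let `Θ₁` distil `T₁` from `E`, let `Θ₂` dilute `T₂` to `E`, and let the free `M` satisfy `T₂ ≤
2^l M` in the completely positive order. Superchannels preserve this order, so `Θ₁Θ₂T₂ ≤ 2^l Θ₁Θ₂M`,
and `Θ₁Θ₂M` is free. On a pure input, `T₁` outputs a pure state `φ`. If `Θ₁Θ₂T₂` passes the test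
`|φ⟩⟨φ|` with probability at least `g = 1/f`, then `Θ₁Θ₂M` passes with probability at least `2^(-l)
g`, so its min-relative entropy from `T₁` is at most `l - log g`. Taking the infimum over `l` gives
the max-relative measure of `T₂`, which equals its min-relative measure.

The bound by `g` compares two pass probabilities: `p` for `Θ₁(E)`, at least `1 - ε₁`
(`fidelity_proj_le_expect`), and `q` for `Θ₁Θ₂T₂`. Pulled back through `Θ₁`, the test becomes a
two-outcome measurement on the outputs of `E` and `Θ₂T₂`, whose fidelity is at least `1 - ε₂`; hence
`√(1-ε₂) ≤ √p√q + √(1-p)√(1-q)` (`Superchannel.exists_le_bhattacharyya`). Two elementary estimates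
of `q` give the two terms of `f`. -/

namespace ResourceTheory

/-! ### Polar decomposition, and fidelity under measurement -/

/-- Every square matrix `Z` factors through a partial isometry `W` with `Wᴴ Z = |Z|`. -/
theorem exists_polar {A : Type*} [Fintype A] [DecidableEq A] (Z : Matrix A A ℂ) :
    ∃ W : Matrix A A ℂ, Wᴴ * Z = CFC.sqrt (Zᴴ * Z) ∧ (1 - W * Wᴴ).PosSemidef := by
  have hZ : (0 : Matrix A A ℂ) ≤ Zᴴ * Z := (Matrix.posSemidef_conjTranspose_mul_self Z).nonneg
  set H := CFC.sqrt (Zᴴ * Z) with hH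
  have hH0 : 0 ≤ H := CFC.sqrt_nonneg _
  have hHH : H * H = Zᴴ * Z := CFC.sqrt_mul_sqrt_self _ hZ
  have hsa : IsSelfAdjoint H := hH0.isSelfAdjoint
  have hc : ∀ f : ℝ → ℝ, ContinuousOn f (spectrum ℝ H) := fun f =>
    (Matrix.finite_real_spectrum (A := H)).continuousOn f
  -- Since `0⁻¹ = 0`, `G` is the pseudo-inverse of `|Z|`; the partial isometry is `Z * G`.
  set G := cfc (fun x : ℝ => x⁻¹) H with hG
  have hGsa : Gᴴ = G := (cfc_predicate (fun x : ℝ => x⁻¹) H : IsSelfAdjoint G)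
  have hid : H = cfc (fun x : ℝ => x) H := (cfc_id' ℝ H).symm
  have h1 : G * (H * H) = H := by
    conv_lhs => rw [hid]
    rw [← cfc_mul _ _ _ (hc _) (hc _), hG, ← cfc_mul _ _ _ (hc _) (hc _)]
    conv_rhs => rw [hid]
    refine cfc_congr fun x _ => ?_
    by_cases hx : x = 0
    · simp [hx]
    · field_simp
  have h2 : G * H * G = G := by
    conv_lhs => rw [hid]
    rw [hG, ← cfc_mul _ _ _ (hc _) (hc _), ← cfc_mul _ _ _ (hc _) (hc _)]
    refine cfc_congr fun x _ => ?_
    by_cases hx : x = 0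
    · simp [hx]
    · field_simp
  have hP : Z * G * (Z * G)ᴴ * (Z * G * (Z * G)ᴴ) = Z * G * (Z * G)ᴴ := by
    rw [Matrix.conjTranspose_mul, hGsa]
    calc Z * G * (G * Zᴴ) * (Z * G * (G * Zᴴ))
        = Z * G * (G * (Zᴴ * Z)) * G * (G * Zᴴ) := by simp only [Matrix.mul_assoc]
      _ = Z * (G * H * G) * (G * Zᴴ) := by rw [← hHH, h1]; simp only [Matrix.mul_assoc]
      _ = _ := by rw [h2]
  refine ⟨Z * G, ?_, ?_⟩
  · rw [Matrix.conjTranspose_mul, hGsa, Matrix.mul_assoc, ← hHH, h1]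
  · have h3 := Matrix.posSemidef_conjTranspose_mul_self (1 - Z * G * (Z * G)ᴴ)
    have h4 : (1 - Z * G * (Z * G)ᴴ)ᴴ * (1 - Z * G * (Z * G)ᴴ) = 1 - Z * G * (Z * G)ᴴ := by
      rw [Matrix.conjTranspose_sub, Matrix.conjTranspose_one, Matrix.conjTranspose_mul (Z * G),
        Matrix.conjTranspose_conjTranspose, Matrix.sub_mul, Matrix.mul_sub, Matrix.mul_sub, hP]
      simp
    rwa [h4] at h3

/-- The discriminant criterion for a nonnegative binary quadratic form. -/
theorem two_mul_le_of_forall_quadratic {a b c : ℝ} (ha : 0 ≤ a) (hb : 0 ≤ b)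
    (h : ∀ s t : ℝ, 0 ≤ s ^ 2 * a - s * t * c + t ^ 2 * b) : c ≤ 2 * (√a * √b) := by
  by_contra! hc
  have hsa := Real.sq_sqrt ha
  have hsb := Real.sq_sqrt hb
  rcases eq_or_lt_of_le ha with ha0 | ha0
  · rw [← ha0] at h hc
    simp only [Real.sqrt_zero, zero_mul, mul_zero] at hc
    -- With `a = 0` these values make the form equal to `-1`.
    have := h ((b + 1) / c) 1
    field_simp at this
    nlinarith
  · have hsa0 := Real.sqrt_pos.2 ha0
    rcases eq_or_lt_of_le hb with hb0 | hb0
    · rw [← hb0] at h hc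
      simp only [Real.sqrt_zero, mul_zero] at hc
      have := h 1 ((a + 1) / c)
      field_simp at this
      nlinarith
    · have hsb0 := Real.sqrt_pos.2 hb0
      have h1 := h (√b) (√a)
      rw [hsa, hsb] at h1
      nlinarith [mul_pos hsa0 hsb0, Real.mul_self_sqrt ha, Real.mul_self_sqrt hb]

/-- The Cauchy-Schwarz inequality for a positive functional on matrices. -/
theorem cauchySchwarz_of_positive {A : Type*} [Fintype A] {L : Matrix A A ℂ →ₗ[ℝ] ℝ}
    (hL : ∀ X : Matrix A A ℂ, X.PosSemidef → 0 ≤ L X) (X Y : Matrix A A ℂ) :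
    L (X * Yᴴ) + L (Y * Xᴴ) ≤ 2 * (√(L (X * Xᴴ)) * √(L (Y * Yᴴ))) := by
  refine two_mul_le_of_forall_quadratic (hL _ (Matrix.posSemidef_self_mul_conjTranspose X))
    (hL _ (Matrix.posSemidef_self_mul_conjTranspose Y)) fun s t => ?_
  have h := hL _ (Matrix.posSemidef_self_mul_conjTranspose (s • X - t • Y))
  simp only [Matrix.conjTranspose_sub, Matrix.conjTranspose_smul, star_trivial, Matrix.sub_mul,
    Matrix.mul_sub, Matrix.smul_mul, Matrix.mul_smul, map_sub, map_smul, smul_eq_mul] at h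
  linarith

/-- The real part of the trace, as a real linear functional. -/
noncomputable def reTrace (A : Type*) [Fintype A] : Matrix A A ℂ →ₗ[ℝ] ℝ :=
  Complex.reLm ∘ₗ Matrix.traceLinearMap A ℝ ℂ

theorem traceNorm_nonneg {A : Type*} [Fintype A] [DecidableEq A] (X : Matrix A A ℂ) :
    0 ≤ traceNorm X :=
  (Complex.le_def.1 (Matrix.nonneg_iff_posSemidef.1 (CFC.sqrt_nonneg (Xᴴ * X))).trace_nonneg).1

/-- The root fidelity of two states is at most that of the outcome distributions of any
two-outcome measurement. -/
theorem traceNorm_sqrt_mul_sqrt_le {A : Type*} [Fintype A] [DecidableEq A]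
    {L : Matrix A A ℂ →ₗ[ℝ] ℝ} (hL : ∀ X : Matrix A A ℂ, X.PosSemidef → 0 ≤ L X)
    (hL' : ∀ X : Matrix A A ℂ, X.PosSemidef → L X ≤ X.trace.re) {ρ σ : Matrix A A ℂ}
    (hρ : ρ.PosSemidef) (hσ : σ.PosSemidef) (hρ1 : ρ.trace = 1) (hσ1 : σ.trace = 1) :
    traceNorm (CFC.sqrt ρ * CFC.sqrt σ) ≤ √(L ρ) * √(L σ) + √(1 - L ρ) * √(1 - L σ) := by
  obtain ⟨W, hW, hW1⟩ := exists_polar (CFC.sqrt ρ * CFC.sqrt σ)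
  have hr : (CFC.sqrt ρ)ᴴ = CFC.sqrt ρ := (CFC.sqrt_nonneg ρ).isSelfAdjoint
  have hs : (CFC.sqrt σ)ᴴ = CFC.sqrt σ := (CFC.sqrt_nonneg σ).isSelfAdjoint
  have hrr : CFC.sqrt ρ * CFC.sqrt ρ = ρ := CFC.sqrt_mul_sqrt_self ρ hρ.nonneg
  have hss : CFC.sqrt σ * CFC.sqrt σ = σ := CFC.sqrt_mul_sqrt_self σ hσ.nonneg
  -- With this choice `Tr(Y Xᴴ) = Tr |√ρ √σ|`, while `W Wᴴ ≤ 1` gives `X Xᴴ ≤ ρ`.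
  set X := CFC.sqrt ρ * W with hX
  set Y := CFC.sqrt σ with hY
  have hYY : Y * Yᴴ = σ := by rw [hs, hss]
  have hXX : (ρ - X * Xᴴ).PosSemidef := by
    have h := hW1.mul_mul_conjTranspose_same (CFC.sqrt ρ)
    rwa [hr, Matrix.mul_sub, Matrix.sub_mul, Matrix.mul_one, hrr,
      show CFC.sqrt ρ * (W * Wᴴ) * CFC.sqrt ρ = X * Xᴴ by
        rw [hX, Matrix.conjTranspose_mul, hr]; simp only [Matrix.mul_assoc]] at h
  -- The complementary outcome: Cauchy-Schwarz for `L` and for `L'` adds up to a bound on the full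
  -- trace.
  set L' : Matrix A A ℂ →ₗ[ℝ] ℝ := reTrace A - L with hLL
  have hL'app : ∀ Z, L' Z = Z.trace.re - L Z := fun Z => rfl
  have hL'0 : ∀ Z : Matrix A A ℂ, Z.PosSemidef → 0 ≤ L' Z := fun Z hZ => by
    rw [hL'app]; linarith [hL' Z hZ]
  have h1 := cauchySchwarz_of_positive hL X Y
  have h2 := cauchySchwarz_of_positive hL'0 X Y
  have hT : (Y * Xᴴ).trace.re = traceNorm (CFC.sqrt ρ * Y) := by
    rw [traceNorm, ← hW, hX, Matrix.conjTranspose_mul, hr, ← Matrix.mul_assoc,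
      Matrix.trace_mul_comm, ← Matrix.mul_assoc, Matrix.trace_mul_comm, ← Matrix.mul_assoc,
      Matrix.trace_mul_comm]
  have hT' : (X * Yᴴ).trace.re = (Y * Xᴴ).trace.re := by
    have : X * Yᴴ = (Y * Xᴴ)ᴴ := by
      rw [Matrix.conjTranspose_mul, Matrix.conjTranspose_conjTranspose]
    rw [this, Matrix.trace_conjTranspose]
    simp
  have h3 : L (X * Xᴴ) ≤ L ρ := by
    have := hL _ hXX; rw [map_sub] at this; linarith
  have h4 : L' (X * Xᴴ) ≤ 1 - L ρ := by
    have := hL'0 _ hXX; rw [map_sub, hL'app ρ, hρ1, Complex.one_re] at this; linarith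
  have h5 : L' (Y * Yᴴ) = 1 - L σ := by rw [hYY, hL'app, hσ1, Complex.one_re]
  rw [hYY] at h1
  rw [h5, hL'app, hL'app] at h2
  have h6 : √(L (X * Xᴴ)) * √(L σ) ≤ √(L ρ) * √(L σ) := by gcongr
  have h7 : √(L' (X * Xᴴ)) * √(1 - L σ) ≤ √(1 - L ρ) * √(1 - L σ) := by gcongr
  linarith

/-! ### Scalar estimates of the second pass probability -/

/-- Write `p = cos² α`, `q = cos² β`. Then `c ≤ cos (α - β)` and `p - q = sin (β - α) sin (β + α)`,
so `(p - q)² ≤ 1 - c² ≤ ε₂`. -/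
theorem sub_sqrt_le_of_bhattacharyya {p q c ε₁ ε₂ : ℝ} (hp : p ∈ Set.Icc (0 : ℝ) 1)
    (hq : q ∈ Set.Icc (0 : ℝ) 1) (hc0 : 0 ≤ c) (hc : c ≤ √p * √q + √(1 - p) * √(1 - q))
    (hp1 : 1 - ε₁ ≤ p) (hc1 : 1 - ε₂ ≤ c ^ 2) : 1 - ε₁ - √ε₂ ≤ q := by
  have a2 := Real.sq_sqrt hp.1
  have b2 := Real.sq_sqrt hq.1
  have a2' := Real.sq_sqrt (sub_nonneg.2 hp.2)
  have b2' := Real.sq_sqrt (sub_nonneg.2 hq.2)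
  have a0 := Real.sqrt_nonneg p
  have b0 := Real.sqrt_nonneg q
  have a0' := Real.sqrt_nonneg (1 - p)
  have b0' := Real.sqrt_nonneg (1 - q)
  set a := √p
  set b := √q
  set a' := √(1 - p)
  set b' := √(1 - q)
  have h1 : c ^ 2 ≤ (a * b + a' * b') ^ 2 := by gcongr
  have h2 : (a * b + a' * b') ^ 2 + (a * b' - a' * b) ^ 2 = 1 := by
    linear_combination (b ^ 2 + b' ^ 2) * (a2 + a2') + b2 + b2'
  have h3 : p - q = (a * b' - a' * b) * (a * b' + a' * b) := by
    linear_combination -b' ^ 2 * a2 + b ^ 2 * a2' - p * b2' + (1 - p) * b2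
  have h4 : (a * b' + a' * b) ^ 2 + (a * b - a' * b') ^ 2 = 1 := by
    linear_combination (b ^ 2 + b' ^ 2) * (a2 + a2') + b2 + b2'
  have h5 : (p - q) ^ 2 ≤ ε₂ := by
    rw [h3, mul_pow]
    nlinarith [sq_nonneg (a * b' - a' * b), sq_nonneg (a * b - a' * b')]
  have h6 := Real.le_sqrt_of_sq_le h5
  linarith

/-- Bounding `√p` and `√(1-q)` by `1` and `√(1-p)` by `√ε₁` leaves `√(1-ε₂) - √ε₁ ≤ √q`; `hε` makes
the left side nonnegative, so it can be squared. -/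
theorem sq_sub_sqrt_le_of_bhattacharyya {p q c ε₁ ε₂ : ℝ} (hp : p ∈ Set.Icc (0 : ℝ) 1)
    (hq : q ∈ Set.Icc (0 : ℝ) 1) (hc0 : 0 ≤ c) (hc : c ≤ √p * √q + √(1 - p) * √(1 - q))
    (hp1 : 1 - ε₁ ≤ p) (hc1 : 1 - ε₂ ≤ c ^ 2) (hε : ε₂ ≤ 1 - ε₁) :
    (√(1 - ε₂) - √ε₁) ^ 2 ≤ q := by
  have h1 : √(1 - ε₂) ≤ c := Real.sqrt_le_iff.2 ⟨hc0, hc1⟩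
  have h2 : √p * √q ≤ 1 * √q := by gcongr; exact Real.sqrt_le_one.2 hp.2
  have h3 : √(1 - p) * √(1 - q) ≤ √ε₁ * 1 := by
    gcongr
    · linarith
    · exact Real.sqrt_le_one.2 (by linarith [hq.1])
  have h4 : √ε₁ ≤ √(1 - ε₂) := Real.sqrt_le_sqrt (by linarith)
  calc (√(1 - ε₂) - √ε₁) ^ 2 ≤ √q ^ 2 := by
        gcongr
        · linarith
    _ = q := Real.sq_sqrt hq.1

/-! ### Pure states and rank-one tests -/

section pure

variable {A : Type*} [Fintype A]

theorem UnitVec.posSemidef_proj (ψ : UnitVec A) : ψ.proj.PosSemidef :=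
  Matrix.posSemidef_vecMulVec_self_star ψ.1

theorem UnitVec.conjTranspose_proj (ψ : UnitVec A) : ψ.projᴴ = ψ.proj :=
  ψ.posSemidef_proj.1

theorem UnitVec.trace_proj (ψ : UnitVec A) : ψ.proj.trace = 1 := by
  rw [UnitVec.proj, Matrix.trace_vecMulVec, dotProduct_comm]
  exact ψ.2

theorem UnitVec.proj_mul_proj (ψ : UnitVec A) : ψ.proj * ψ.proj = ψ.proj := by
  rw [UnitVec.proj, Matrix.vecMulVec_mul_vecMulVec, ψ.2, one_smul]

theorem trace_mul_re_nonneg {P X : Matrix A A ℂ} (hP : Pᴴ = P) (hPP : P * P = P)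
    (hX : X.PosSemidef) : 0 ≤ (P * X).trace.re := by
  have h := (hX.mul_mul_conjTranspose_same P).trace_nonneg
  rw [hP, Matrix.trace_mul_comm, ← Matrix.mul_assoc, hPP] at h
  exact (Complex.le_def.1 h).1

/-- The expectation `⟨φ|X|φ⟩`. -/
noncomputable def UnitVec.expect (φ : UnitVec A) : Matrix A A ℂ →ₗ[ℝ] ℝ :=
  reTrace A ∘ₗ LinearMap.mulLeft ℝ φ.proj

theorem UnitVec.expect_apply (φ : UnitVec A) (X : Matrix A A ℂ) :
    φ.expect X = (φ.proj * X).trace.re := rfl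

theorem UnitVec.expect_nonneg (φ : UnitVec A) {X : Matrix A A ℂ} (hX : X.PosSemidef) :
    0 ≤ φ.expect X :=
  trace_mul_re_nonneg φ.conjTranspose_proj φ.proj_mul_proj hX

theorem UnitVec.expect_le_trace [DecidableEq A] (φ : UnitVec A) {X : Matrix A A ℂ}
    (hX : X.PosSemidef) : φ.expect X ≤ X.trace.re := by
  have h := trace_mul_re_nonneg (P := 1 - φ.proj)
    (by rw [Matrix.conjTranspose_sub, Matrix.conjTranspose_one, φ.conjTranspose_proj])
    (by rw [Matrix.sub_mul, Matrix.mul_sub, Matrix.mul_sub, φ.proj_mul_proj]; simp) hX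
  rw [Matrix.sub_mul, Matrix.one_mul, Matrix.trace_sub, Complex.sub_re] at h
  rw [UnitVec.expect_apply]
  linarith

theorem UnitVec.expect_proj_self (φ : UnitVec A) : φ.expect φ.proj = 1 := by
  rw [UnitVec.expect_apply, φ.proj_mul_proj, φ.trace_proj, Complex.one_re]

/-- In the test `|φ⟩⟨φ|` the state `φ` never fails, so the second term of the measured root fidelity
vanishes. -/
theorem fidelity_proj_le_expect [DecidableEq A] (φ : UnitVec A) {ρ : Matrix A A ℂ}
    (hρ : ρ.PosSemidef) (hρ1 : ρ.trace = 1) : fidelity ρ φ.proj ≤ φ.expect ρ := by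
  have h := traceNorm_sqrt_mul_sqrt_le (fun X hX => φ.expect_nonneg hX)
    (fun X hX => φ.expect_le_trace hX) hρ φ.posSemidef_proj hρ1 φ.trace_proj
  rw [φ.expect_proj_self, sub_self, Real.sqrt_zero, mul_zero, add_zero, Real.sqrt_one,
    mul_one] at h
  calc fidelity ρ φ.proj ≤ √(φ.expect ρ) ^ 2 := by
        unfold fidelity
        have := traceNorm_nonneg (CFC.sqrt ρ * CFC.sqrt φ.proj)
        gcongr
    _ = φ.expect ρ := Real.sq_sqrt (φ.expect_nonneg hρ)

theorem supportProj_proj [DecidableEq A] (φ : UnitVec A) : supportProj φ.proj = φ.proj := by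
  have hφ : (star φ.1 ⬝ᵥ φ.1) = 1 := φ.2
  have happ : ∀ w : EuclideanSpace ℂ A, Matrix.toEuclideanLin φ.proj w =
      inner ℂ (WithLp.toLp 2 φ.1) w • (WithLp.toLp 2 φ.1 : EuclideanSpace ℂ A) := by
    intro w
    ext i
    rw [Matrix.toLpLin_apply]
    simp [UnitVec.proj, Matrix.vecMulVec_mulVec, EuclideanSpace.inner_eq_star_dotProduct,
      dotProduct_comm, mul_comm]
  have hnorm : ‖(WithLp.toLp 2 φ.1 : EuclideanSpace ℂ A)‖ = 1 := by
    rw [← sq_eq_sq₀ (norm_nonneg _) zero_le_one, one_pow]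
    have h := inner_self_eq_norm_sq_to_K (𝕜 := ℂ) (WithLp.toLp 2 φ.1 : EuclideanSpace ℂ A)
    rw [EuclideanSpace.inner_eq_star_dotProduct, dotProduct_comm, hφ] at h
    exact RCLike.ofReal_injective (K := ℂ) (by push_cast; exact h.symm)
  have hrange : LinearMap.range (Matrix.toEuclideanLin φ.proj) =
      Submodule.span ℂ {(WithLp.toLp 2 φ.1 : EuclideanSpace ℂ A)} := by
    apply le_antisymm
    · rintro _ ⟨w, rfl⟩
      rw [happ]
      exact Submodule.smul_mem _ _ (Submodule.mem_span_singleton_self _)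
    · rw [Submodule.span_singleton_le_iff_mem]
      refine ⟨WithLp.toLp 2 φ.1, ?_⟩
      rw [happ, inner_self_eq_norm_sq_to_K, hnorm]
      simp
  unfold supportProj
  rw [LinearEquiv.symm_apply_eq]
  ext1 w
  rw [happ]
  simp only [hrange]
  exact Submodule.starProjection_unit_singleton ℂ hnorm w

theorem Dmin_proj [DecidableEq A] (φ : UnitVec A) (σ : Matrix A A ℂ) :
    Dmin φ.proj σ = -log2 (ENNReal.ofReal (φ.expect σ)) := by
  rw [Dmin, supportProj_proj, UnitVec.expect_apply]

/-- Any positive semidefinite matrix is a sum of rank-one ones. -/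
theorem eq_sum_vecMulVec [DecidableEq A] {X : Matrix A A ℂ} (hX : X.PosSemidef) :
    ∃ v : A → A → ℂ, X = ∑ k, Matrix.vecMulVec (v k) (star (v k)) := by
  have hs : (CFC.sqrt X)ᴴ = CFC.sqrt X := (CFC.sqrt_nonneg X).isSelfAdjoint
  refine ⟨fun k i => CFC.sqrt X i k, ?_⟩
  conv_lhs => rw [← CFC.sqrt_mul_sqrt_self X hX.nonneg]
  nth_rewrite 2 [← hs]
  ext i j
  simp [Matrix.mul_apply, Matrix.sum_apply, Matrix.vecMulVec_apply]

theorem vecMulVec_eq_smul_proj (v : A → ℂ) (hv : v ≠ 0) :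
    ∃ (r : ℝ) (ψ : UnitVec A), 0 ≤ r ∧ Matrix.vecMulVec v (star v) = (r : ℂ) • ψ.proj := by
  have h0 : 0 < star v ⬝ᵥ v := Matrix.dotProduct_star_self_pos_iff.2 hv
  obtain ⟨h1, h2⟩ := Complex.lt_def.1 h0
  set s := (star v ⬝ᵥ v).re with hs
  have hsv : star v ⬝ᵥ v = (s : ℂ) := Complex.ext rfl (by simpa using h2.symm)
  have hs0 : 0 < s := h1
  have hsq : ((√s : ℝ) : ℂ) * (√s : ℝ) = s := by
    rw [← Complex.ofReal_mul, Real.mul_self_sqrt hs0.le]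
  have hne : ((√s : ℝ) : ℂ) ≠ 0 := by exact_mod_cast (Real.sqrt_pos.2 hs0).ne'
  have hstar : star (((√s : ℝ) : ℂ)⁻¹ • v) = ((√s : ℝ) : ℂ)⁻¹ • star v := by
    rw [star_smul]; simp
  refine ⟨s, ⟨((√s : ℝ) : ℂ)⁻¹ • v, ?_⟩, hs0.le, ?_⟩
  · rw [hstar, smul_dotProduct, dotProduct_smul, hsv, ← hsq]
    simp only [smul_eq_mul]
    field_simp
  · unfold UnitVec.proj
    simp only
    rw [hstar, Matrix.smul_vecMulVec, Matrix.vecMulVec_smul, smul_smul, smul_smul, ← hsq,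
      show ((√s : ℝ) : ℂ) * (√s : ℝ) * ((√s : ℝ) : ℂ)⁻¹ * ((√s : ℝ) : ℂ)⁻¹ = 1 by field_simp,
      one_smul]

end pure

/-! ### Complete positivity and the order on channels -/

section channel

theorem idTensor_smul_sub {R A B : Type*} (c : ℂ) (Φ Ψ : Matrix A A ℂ →ₗ[ℂ] Matrix B B ℂ)
    (X : Matrix (R × A) (R × A) ℂ) :
    idTensor R (c • Φ - Ψ) X = c • idTensor R Φ X - idTensor R Ψ X := rfl

/-- A map which is positive on pure inputs with reference is completely positive. -/
theorem isCompletelyPositive_of_proj {A B : Type*} [Fintype A] [DecidableEq A]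
    {Φ : Matrix A A ℂ →ₗ[ℂ] Matrix B B ℂ}
    (h : ∀ (n : ℕ) (ψ : UnitVec (Fin n × A)), (idTensor (Fin n) Φ ψ.proj).PosSemidef) :
    IsCompletelyPositive Φ := by
  intro n X hX
  obtain ⟨v, rfl⟩ := eq_sum_vecMulVec hX
  rw [map_sum]
  refine Matrix.posSemidef_sum _ fun k _ => ?_
  by_cases hk : v k = 0
  · rw [hk, Matrix.zero_vecMulVec, map_zero]
    exact Matrix.PosSemidef.zero
  · obtain ⟨r, ψ, hr, h1⟩ := vecMulVec_eq_smul_proj _ hk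
    rw [h1, map_smul]
    exact (h n ψ).smul (by exact_mod_cast hr)

variable {A B : Type*} [Fintype A] [Fintype B]

theorem Channel.posSemidef_idTensor (E : Channel A B) {n : ℕ} (ψ : UnitVec (Fin n × A)) :
    (idTensor (Fin n) E.toLin ψ.proj).PosSemidef :=
  E.completelyPositive n _ ψ.posSemidef_proj

theorem Channel.trace_idTensor (E : Channel A B) {n : ℕ} (ψ : UnitVec (Fin n × A)) :
    (idTensor (Fin n) E.toLin ψ.proj).trace = 1 := by
  rw [E.tracePreserving.idTensor n, ψ.trace_proj]

theorem channelFidelity_le [DecidableEq B] (E N : Channel A B) {n : ℕ} (ψ : UnitVec (Fin n × A)) :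
    channelFidelity E N ≤
      fidelity (idTensor (Fin n) E.toLin ψ.proj) (idTensor (Fin n) N.toLin ψ.proj) :=
  csInf_le ⟨0, by rintro x ⟨n, ψ, rfl⟩; exact sq_nonneg _⟩ ⟨n, ψ, rfl⟩

theorem isCompletelyPositive_of_channelDmax_lt [DecidableEq A] {T M : Channel A B} {l : ℝ}
    (h : channelDmax T M < l) :
    IsCompletelyPositive ((((2 : ℝ) ^ l : ℝ) : ℂ) • M.toLin - T.toLin) := by
  refine isCompletelyPositive_of_proj fun n ψ => ?_
  have h1 : Dmax (idTensor (Fin n) T.toLin ψ.proj) (idTensor (Fin n) M.toLin ψ.proj) < l :=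
    (le_iSup₂ (f := fun (n : ℕ) (ψ : UnitVec (Fin n × A)) =>
      Dmax (idTensor (Fin n) T.toLin ψ.proj) (idTensor (Fin n) M.toLin ψ.proj)) n ψ).trans_lt h
  simp only [Dmax, iInf_lt_iff] at h1
  obtain ⟨k, hk, hkl⟩ := h1
  have hkl' : (2 : ℝ) ^ k ≤ (2 : ℝ) ^ l :=
    Real.rpow_le_rpow_of_exponent_le one_le_two (EReal.coe_lt_coe_iff.1 hkl).le
  -- The exponent `k < l` depends on `ψ`; adding `(2^l - 2^k) M(ψ) ≥ 0` raises it to the uniform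
  -- `l`.
  have h2 := hk.add ((M.posSemidef_idTensor ψ).smul (sub_nonneg.2 hkl'))
  rw [idTensor_smul_sub]
  convert h2 using 1
  rw [sub_smul, Complex.coe_smul]
  abel

variable {A' B' : Type*} [Fintype A'] [Fintype B']

/-- Needed for the difference `2^l M - T`, which is not a channel. -/
theorem Superchannel.isCompletelyPositive_toLin (Θ : Superchannel A B A' B')
    {Φ : Matrix A A ℂ →ₗ[ℂ] Matrix B B ℂ} (hΦ : IsCompletelyPositive Φ) :
    IsCompletelyPositive (Θ.toLin Φ) := by
  obtain ⟨m, pre, post, h⟩ := Θ.realizable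
  rw [h]
  exact post.completelyPositive.comp ((hΦ.idTensor m).comp pre.completelyPositive)

end channel

/-! ### Partial traces and purifications -/

section reference

variable {R K I J : Type*} [Fintype K]

/-- The partial trace over a factor `K` of the reference system. -/
def refTrace (e : K × I × J ≃ R) (B : Type*) :
    Matrix (R × B) (R × B) ℂ →ₗ[ℂ] Matrix (I × J × B) (I × J × B) ℂ where
  toFun Z := ∑ k, Z.submatrix (fun p => (e (k, p.1, p.2.1), p.2.2))
    (fun p => (e (k, p.1, p.2.1), p.2.2))
  map_add' X Y := by
    simp only [Matrix.submatrix_add, Pi.add_apply, Finset.sum_add_distrib]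
  map_smul' c X := by
    simp only [Matrix.submatrix_smul, Pi.smul_apply, Finset.smul_sum, RingHom.id_apply]

theorem refTrace_apply (e : K × I × J ≃ R) {B : Type*} (Z : Matrix (R × B) (R × B) ℂ)
    (p q : I × J × B) : refTrace e B Z p q =
      ∑ k, Z (e (k, p.1, p.2.1), p.2.2) (e (k, q.1, q.2.1), q.2.2) := by
  exact Matrix.sum_apply _ _ _ _

theorem posSemidef_refTrace (e : K × I × J ≃ R) {B : Type*} {Z : Matrix (R × B) (R × B) ℂ}
    (hZ : Z.PosSemidef) : (refTrace e B Z).PosSemidef :=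
  Matrix.posSemidef_sum _ fun _ _ => hZ.submatrix _

theorem trace_refTrace [Fintype I] [Fintype J] [Fintype R] (e : K × I × J ≃ R) {B : Type*}
    [Fintype B] (Z : Matrix (R × B) (R × B) ℂ) : (refTrace e B Z).trace = Z.trace := by
  simp only [Matrix.trace, Matrix.diag_apply, refTrace_apply]
  rw [Finset.sum_comm]
  simp only [Fintype.sum_prod_type]
  rw [← e.sum_comp]
  simp only [Fintype.sum_prod_type]

theorem refTrace_idTensor (e : K × I × J ≃ R) {A B : Type*}
    (Φ : Matrix A A ℂ →ₗ[ℂ] Matrix B B ℂ) (Z : Matrix (R × A) (R × A) ℂ) :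
    refTrace e B (idTensor R Φ Z) = idTensor I (idTensor J Φ) (refTrace e A Z) := by
  ext p q
  rw [refTrace_apply]
  have h : (Matrix.of fun a a' => refTrace e A Z (p.1, p.2.1, a) (q.1, q.2.1, a')) =
      ∑ k, Matrix.of fun a a' => Z (e (k, p.1, p.2.1), a) (e (k, q.1, q.2.1), a') := by
    ext a a'
    simp [refTrace_apply, Matrix.sum_apply]
  have h2 := congrFun (congrFun (congrArg Φ h) p.2.2) q.2.2
  rw [map_sum, Matrix.sum_apply] at h2
  exact h2.symm

/-- Every state has a purification. -/
theorem exists_purification [Fintype I] [Fintype J] [Fintype R] {A : Type*} [Fintype A]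
    [DecidableEq I] [DecidableEq J] [DecidableEq A] (e : (I × J × A) × I × J ≃ R)
    {ω : Matrix (I × J × A) (I × J × A) ℂ} (hω : ω.PosSemidef) (hω1 : ω.trace = 1) :
    ∃ χ : UnitVec (R × A), refTrace e A χ.proj = ω := by
  obtain ⟨v, hv⟩ := eq_sum_vecMulVec hω
  -- The vector `∑ₖ |k⟩ ⊗ v k`, with the `k` register and the factors `I`, `J` merged into the
  -- reference `R`.
  set x : R × A → ℂ := fun r =>
    v (e.symm r.1).1 ((e.symm r.1).2.1, (e.symm r.1).2.2, r.2) with hx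
  have h : refTrace e A (Matrix.vecMulVec x (star x)) = ω := by
    rw [hv]
    ext p q
    simp [refTrace_apply, Matrix.sum_apply, Matrix.vecMulVec_apply, hx]
  refine ⟨⟨x, ?_⟩, h⟩
  rw [dotProduct_comm, ← Matrix.trace_vecMulVec, ← trace_refTrace e, h, hω1]

end reference

/-! ### Fidelity under superchannels -/

/-- The fidelity of channels bounds the overlap of the probabilities with which the outputs of a
superchannel pass a test. -/
theorem Superchannel.exists_le_bhattacharyya {A B A' B' : Type*} [Fintype A] [Fintype B]
    [Fintype A'] [Fintype B'] [DecidableEq A] [DecidableEq B] [DecidableEq B']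
    (Θ : Superchannel A B A' B') (E N : Channel A B) {n : ℕ} (ψ : UnitVec (Fin n × A'))
    (φ : UnitVec (Fin n × B')) :
    ∃ c : ℝ, 0 ≤ c ∧ channelFidelity E N ≤ c ^ 2 ∧
      c ≤ √(φ.expect (idTensor (Fin n) (Θ.apply E).toLin ψ.proj)) *
          √(φ.expect (idTensor (Fin n) (Θ.apply N).toLin ψ.proj)) +
        √(1 - φ.expect (idTensor (Fin n) (Θ.apply E).toLin ψ.proj)) *
          √(1 - φ.expect (idTensor (Fin n) (Θ.apply N).toLin ψ.proj)) := by
  obtain ⟨m, pre, post, h⟩ := Θ.realizable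
  set e := Fintype.equivFin ((Fin n × Fin m × A) × Fin n × Fin m)
  -- The pre-processed state may be mixed, whereas the channel fidelity tests pure inputs; the outer
  -- reference and the memory become part of the reference of `χ`.
  obtain ⟨χ, hχ⟩ := exists_purification e (pre.posSemidef_idTensor ψ) (pre.trace_idTensor ψ)
  have hout : ∀ F : Channel A B, idTensor (Fin n) (Θ.apply F).toLin ψ.proj =
      idTensor (Fin n) post.toLin (refTrace e B (idTensor _ F.toLin χ.proj)) := by
    intro F
    rw [refTrace_idTensor, hχ, show (Θ.apply F).toLin = Θ.toLin F.toLin from rfl, h]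
    rfl
  -- The test `φ` pulled back through the post-processing and the partial trace over the purifying
  -- register.
  set L : Matrix (Fin _ × B) (Fin _ × B) ℂ →ₗ[ℝ] ℝ := φ.expect ∘ₗ
    (idTensor (Fin n) post.toLin ∘ₗ refTrace e B).restrictScalars ℝ
  have hL : ∀ Z, L Z = φ.expect (idTensor (Fin n) post.toLin (refTrace e B Z)) := fun Z => rfl
  have hpos : ∀ Z : Matrix (Fin _ × B) (Fin _ × B) ℂ, Z.PosSemidef →
      (idTensor (Fin n) post.toLin (refTrace e B Z)).PosSemidef := fun Z hZ =>
    post.completelyPositive n _ (posSemidef_refTrace e hZ)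
  refine ⟨_, traceNorm_nonneg _, channelFidelity_le E N χ, ?_⟩
  rw [hout, hout, ← hL, ← hL]
  refine traceNorm_sqrt_mul_sqrt_le (L := L) (fun Z hZ => φ.expect_nonneg (hpos Z hZ)) (fun Z hZ => ?_)
    (E.posSemidef_idTensor χ) (N.posSemidef_idTensor χ) (E.trace_idTensor χ) (N.trace_idTensor χ)
  have h1 := φ.expect_le_trace (hpos Z hZ)
  rwa [post.tracePreserving.idTensor n, trace_refTrace] at h1

/-! ### The error factor and logarithms -/

/-- The minimum of inverses is the inverse of a maximum, so `g` is the better of the two available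
lower bounds on `q`. -/
theorem errorFactor_eq_inv {ε₁ ε₂ : ℝ} (hε : ε₂ ≤ 1 - ε₁) (hε₁ : 0 ≤ ε₁) (hε₂ : 0 ≤ ε₂) :
    ∃ g : ℝ, 0 ≤ g ∧ g ≤ 1 ∧ errorFactor ε₁ ε₂ = (ENNReal.ofReal g)⁻¹ ∧
      ∀ q, (ε₁ + √ε₂ < 1 → 1 - ε₁ - √ε₂ ≤ q) → (√(1 - ε₂) - √ε₁) ^ 2 ≤ q → g ≤ q := by
  have h1 : √(1 - ε₂) ≤ 1 := Real.sqrt_le_one.2 (by linarith)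
  have h2 : √ε₁ ≤ √(1 - ε₂) := Real.sqrt_le_sqrt (by linarith)
  have h3 : (√(1 - ε₂) - √ε₁) ^ 2 ≤ 1 :=
    pow_le_one₀ (by linarith) (by linarith [Real.sqrt_nonneg ε₁])
  unfold errorFactor
  split_ifs with h
  · refine ⟨max (1 - ε₁ - √ε₂) ((√(1 - ε₂) - √ε₁) ^ 2), le_max_of_le_right (sq_nonneg _),
      max_le (by linarith [Real.sqrt_nonneg ε₂]) h3, ?_, fun q ha hb => max_le (ha h) hb⟩
    rw [ENNReal.ofReal_max]
    exact (ENNReal.inv_strictAnti.antitone.map_max).symm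
  · exact ⟨_, sq_nonneg _, h3, rfl, fun q _ hb => hb⟩

theorem log2_inv_ofReal_of_pos {g : ℝ} (hg : 0 < g) :
    log2 (ENNReal.ofReal g)⁻¹ = ((-Real.logb 2 g : ℝ) : EReal) := by
  have h0 : (ENNReal.ofReal g)⁻¹ ≠ 0 := ENNReal.inv_ne_zero.2 ENNReal.ofReal_ne_top
  have h1 : (ENNReal.ofReal g)⁻¹ ≠ ⊤ :=
    ENNReal.inv_ne_top.2 (ENNReal.ofReal_pos.2 hg).ne'
  rw [log2, if_neg h0, if_neg h1, ENNReal.toReal_inv, ENNReal.toReal_ofReal hg.le, Real.logb_inv]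

theorem log2_ofReal_of_pos {q : ℝ} (hq : 0 < q) :
    log2 (ENNReal.ofReal q) = ((Real.logb 2 q : ℝ) : EReal) := by
  rw [log2, if_neg (ENNReal.ofReal_pos.2 hq).ne', if_neg ENNReal.ofReal_ne_top,
    ENNReal.toReal_ofReal hq.le]

theorem neg_log2_le {q g l : ℝ} (hg : 0 < g) (h : g ≤ 2 ^ l * q) :
    -log2 (ENNReal.ofReal q) ≤ ((l - Real.logb 2 g : ℝ) : EReal) := by
  have h2 : (0 : ℝ) < 2 ^ l := Real.rpow_pos_of_pos two_pos l
  have hq : 0 < q := pos_of_mul_pos_right (hg.trans_le h) h2.le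
  rw [log2_ofReal_of_pos hq, ← EReal.coe_neg, EReal.coe_le_coe_iff]
  have h3 := Real.logb_le_logb_of_le one_lt_two hg h
  rw [Real.logb_mul h2.ne' hq.ne', Real.logb_rpow two_pos (by norm_num)] at h3
  linarith

theorem neg_log2_nonneg {q : ℝ} (h : q ≤ 1) : 0 ≤ -log2 (ENNReal.ofReal q) := by
  rcases le_or_gt q 0 with h0 | h0
  · rw [ENNReal.ofReal_of_nonpos h0, log2, if_pos rfl, EReal.neg_bot]
    exact le_top
  · rw [log2_ofReal_of_pos h0, ← EReal.coe_neg, ← EReal.coe_zero, EReal.coe_le_coe_iff]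
    linarith [Real.logb_nonpos one_lt_two h0.le h]

/-- Keeps the dilution cost away from `-∞`, so that adding `log ∞` to it gives `∞`. -/
theorem channelDmin_nonneg {A B : Type*} [Fintype A] [Fintype B] [DecidableEq B] [Nonempty A]
    {T : Channel A B} (hT : T.IsPure) (M : Channel A B) : 0 ≤ channelDmin T M := by
  classical
  let a : Fin 1 × A := (0, Classical.arbitrary A)
  let ψ : UnitVec (Fin 1 × A) := ⟨Pi.single a 1, by simp⟩
  refine le_trans ?_ (le_iSup₂ (f := fun (n : ℕ) (ψ : UnitVec (Fin n × A)) =>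
    Dmin (idTensor (Fin n) T.toLin ψ.proj) (idTensor (Fin n) M.toLin ψ.proj)) 1 ψ)
  obtain ⟨φ, hφ⟩ := hT 1 ψ
  rw [hφ, Dmin_proj]
  refine neg_log2_nonneg ((φ.expect_le_trace (M.posSemidef_idTensor ψ)).trans_eq ?_)
  rw [M.trace_idTensor, Complex.one_re]

/-! ### Composition of dilution and distillation -/

theorem expect_le_of_isCompletelyPositive {A B : Type*} [Fintype A] [Fintype B] {c : ℝ}
    {T M : Matrix A A ℂ →ₗ[ℂ] Matrix B B ℂ} (h : IsCompletelyPositive ((c : ℂ) • M - T))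
    {n : ℕ} (ψ : UnitVec (Fin n × A)) (φ : UnitVec (Fin n × B)) :
    φ.expect (idTensor (Fin n) T ψ.proj) ≤ c * φ.expect (idTensor (Fin n) M ψ.proj) := by
  have h1 := φ.expect_nonneg (h n _ ψ.posSemidef_proj)
  rw [idTensor_smul_sub, map_sub, Complex.coe_smul, map_smul, smul_eq_mul] at h1
  linarith

/-- Converting a channel `T₂` to `T₁` via `E` by superchannels with small errors. -/
theorem channelDmin_apply_apply_le {A B A₁ B₁ A₂ B₂ : Type*} [Fintype A] [Fintype B] [Fintype A₁]
    [Fintype B₁] [Fintype A₂] [Fintype B₂] [DecidableEq A] [DecidableEq B] [DecidableEq B₁]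
    [DecidableEq A₂] {ε₁ ε₂ g : ℝ} (hε : ε₂ ≤ 1 - ε₁) (hg : 0 < g)
    (hgq : ∀ q, (ε₁ + √ε₂ < 1 → 1 - ε₁ - √ε₂ ≤ q) → (√(1 - ε₂) - √ε₁) ^ 2 ≤ q → g ≤ q)
    {E : Channel A B} {T₁ : Channel A₁ B₁} {T₂ M : Channel A₂ B₂} (hT₁ : T₁.IsPure)
    {Θ₁ : Superchannel A B A₁ B₁} {Θ₂ : Superchannel A₂ B₂ A B}
    (h₁ : 1 - ε₁ ≤ channelFidelity (Θ₁.apply E) T₁)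
    (h₂ : 1 - ε₂ ≤ channelFidelity E (Θ₂.apply T₂)) {l : ℝ} (hl : channelDmax T₂ M < l) :
    channelDmin T₁ (Θ₁.apply (Θ₂.apply M)) ≤ ((l - Real.logb 2 g : ℝ) : EReal) := by
  refine iSup₂_le fun n ψ => ?_
  obtain ⟨φ, hφ⟩ := hT₁ n ψ
  rw [hφ, Dmin_proj]
  refine neg_log2_le hg (le_trans ?_ (expect_le_of_isCompletelyPositive
    (T := (Θ₁.apply (Θ₂.apply T₂)).toLin) ?_ ψ φ))
  · obtain ⟨c, hc0, hcF, hc⟩ := Θ₁.exists_le_bhattacharyya E (Θ₂.apply T₂) ψ φ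
    have hmem : ∀ F : Channel A₁ B₁,
        φ.expect (idTensor (Fin n) F.toLin ψ.proj) ∈ Set.Icc (0 : ℝ) 1 := fun F =>
      ⟨φ.expect_nonneg (F.posSemidef_idTensor ψ),
        (φ.expect_le_trace (F.posSemidef_idTensor ψ)).trans_eq
          (by rw [F.trace_idTensor, Complex.one_re])⟩
    have hp : 1 - ε₁ ≤ φ.expect (idTensor (Fin n) (Θ₁.apply E).toLin ψ.proj) := by
      refine (h₁.trans (channelFidelity_le _ _ ψ)).trans ?_
      rw [hφ]
      exact fidelity_proj_le_expect φ (Channel.posSemidef_idTensor _ ψ)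
        (Channel.trace_idTensor _ ψ)
    exact hgq _
      (fun _ => sub_sqrt_le_of_bhattacharyya (hmem _) (hmem _) hc0 hc hp (h₂.trans hcF))
      (sq_sub_sqrt_le_of_bhattacharyya (hmem _) (hmem _) hc0 hc hp (h₂.trans hcF) hε)
  · have h := Θ₁.isCompletelyPositive_toLin
      (Θ₂.isCompletelyPositive_toLin (isCompletelyPositive_of_channelDmax_lt hl))
    rwa [map_sub, map_smul, map_sub, map_smul] at h

end ResourceTheory

theorem theorem1 {Sys : Type*} (H : Sys → Type*) [∀ s, Fintype (H s)] [∀ s, DecidableEq (H s)]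
    [∀ s, Nonempty (H s)]
    (𝒪 𝒪' : ChannelTheory H)
    (𝒯 : ChannelSet H) (h𝒯 : 𝒯 ≤ 𝒪'.all)
    (hpure : ∀ A' B', ∀ T ∈ 𝒯 A' B', T.IsPure)
    (heq : ∀ A' B', ∀ T ∈ 𝒯 A' B', resourceDmin 𝒪' T = resourceDmax 𝒪' T)
    (ε₁ ε₂ : ℝ) (hε₁ : ε₁ ∈ Set.Ico (0 : ℝ) 1) (hε₂ : ε₂ ∈ Set.Icc (0 : ℝ) (1 - ε₁))
    {A B : Sys} (E : Channel (H A) (H B))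
    (S S' : SuperchannelSet H)
    (hS : S ≤ maxFreeSuperchannels 𝒪 𝒪') (hS' : S' ≤ maxFreeSuperchannels 𝒪' 𝒪) :
    distillableResource 𝒪' 𝒯 S ε₁ E ≤
      dilutionCost 𝒪' 𝒯 S' ε₂ E + log2 (errorFactor ε₁ ε₂) := by
  obtain ⟨g, hg0, hg1, hf, hgq⟩ := errorFactor_eq_inv hε₂.2 hε₁.1 hε₂.1
  have hcost : 0 ≤ dilutionCost 𝒪' 𝒯 S' ε₂ E := by
    refine le_sInf ?_
    rintro _ ⟨A', B', T, hT, Θ, -, -, rfl⟩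
    exact le_iInf₂ fun M _ => channelDmin_nonneg (hpure _ _ T hT) M
  rw [hf]
  -- For `g = 0` the error factor is `∞` and the bound is trivial.
  rcases hg0.eq_or_lt with rfl | hg
  · rw [ENNReal.ofReal_zero, ENNReal.inv_zero, log2, if_neg ENNReal.top_ne_zero, if_pos rfl,
      EReal.add_top_of_ne_bot (ne_of_gt ((EReal.bot_lt_coe 0).trans_le hcost))]
    exact le_top
  refine sSup_le ?_
  rintro _ ⟨A₁, B₁, T₁, hT₁, Θ₁, hΘ₁, h₁, rfl⟩
  rw [log2_inv_ofReal_of_pos hg, EReal.coe_neg, ← sub_eq_add_neg,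
    EReal.le_sub_iff_add_le (Or.inl (EReal.coe_ne_bot _)) (Or.inl (EReal.coe_ne_top _))]
  refine le_sInf ?_
  rintro _ ⟨A₂, B₂, T₂, hT₂, Θ₂, hΘ₂, h₂, rfl⟩
  -- The infimum defining the max-relative measure need not be attained, so it is approached by
  -- reals `l` strictly above it; this also covers infinite values.
  rw [heq _ _ T₂ hT₂, ← EReal.le_of_forall_lt_iff_le]
  intro l hl
  simp only [resourceDmax, iInf_lt_iff] at hl
  obtain ⟨M, hM, hl⟩ := hl
  rw [← EReal.le_sub_iff_add_le (Or.inl (EReal.coe_ne_bot _)) (Or.inl (EReal.coe_ne_top _)),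
    ← EReal.coe_sub]
  exact (iInf₂_le _ ((hS _ _ _ _ hΘ₁).2 _ ((hS' _ _ _ _ hΘ₂).2 M hM))).trans
    (channelDmin_apply_apply_le hε₂.2 hg hgq (hpure _ _ T₁ hT₁) h₁ h₂ hl)
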